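/- Let $K$ be a field, let $n,m,q,r$ be integers with $1\le q\le n$ and $1\le r\le m$, and let $S=K[x_1,\dots,x_n,y_1,\dots,y_m]$. Let $I_q\subset S$ be the ideal generated by all square-free monomials of degree $q$ in $x_1,\dots,x_n$, and let $J_r\subset S$ be the ideal generated by all square-free monomials of degree $r$ in $y_1,\dots,y_m$. Suppose that $S/I_qJ_r$ is a Cohen–Macaulay ring. Then $q=n$ and $r=m$, so that the ideal $I_qJ_r$ is principal, and the type of the standard graded algebra $S/I_qJ_r$ is $1$. Moreover, $S/I_qJ_r$ is Gorenstein. Here the type of a Cohen–Macaulay standard graded $K$-algebra $R$ with homogeneous maximal ideal $\mathfrak m$ is $\dim_K\operatorname{Ext}^t_R(R/\mathfrak m,R)$ with $t=\operatorname{depth}(\mathfrak m,R)$, and a Gorenstein ring is a Cohen–Macaulay ring $R$ such that $\dim_{R/P}\operatorname{Ext}_R^{t}(R/P,R)=1$, with $t=\operatorname{depth}(P,R)$, for every maximal ideal $P$ of $R$. -/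

import Mathlib

noncomputable section

namespace MixedProduct

open CategoryTheory

universe u

section Commutative

variable {R : Type u} [CommRing R]

/-- The grade (also written `depth (I, R)`) of an ideal `I` on `R`: the supremum of the lengths of
the `R`-regular sequences contained in `I`. For a proper ideal of a Noetherian ring it is the
common (finite) length of all maximal regular sequences in `I`; for a maximal ideal `P` of a
Noetherian ring it is the depth of the local ring `R_P`. -/
def idealDepth (I : Ideal R) : ℕ∞ :=
  ⨆ (rs : List R) (_ : ∀ r ∈ rs, r ∈ I) (_ : RingTheory.Sequence.IsRegular R rs),
    (rs.length : ℕ∞)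

variable (R) in
/-- A Cohen-Macaulay ring: Noetherian, with `depth (P, R) = codim P` for each maximal ideal `P`;
that is, `depth R_P = dim R_P` for each maximal ideal `P`. -/
def IsCohenMacaulay : Prop :=
  IsNoetherianRing R ∧ ∀ P : Ideal R, P.IsMaximal → idealDepth P = P.height

/-- The type of `R` at a maximal ideal `P`: the dimension over the field `R ⧸ P` of
`Ext_R^t (R ⧸ P, R)`, where `t` is the grade of `P` (the depth of `R_P`). This module is killed
by `P`, so that its dimension over `R ⧸ P` is its length over `R`. It is also the dimension of
`Ext^t (k, R_P)` over `R_P`, with `k` the residue field of `R_P`, when `R` is Noetherian. -/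
def typeAt (P : Ideal R) : ℕ∞ :=
  Module.length R
    (Abelian.Ext (ModuleCat.of R (R ⧸ P)) (ModuleCat.of R R) (idealDepth P).toNat)

variable (R) in
/-- A Gorenstein ring: a Cohen-Macaulay ring that has type `1` at each maximal ideal. -/
def IsGorenstein : Prop :=
  IsCohenMacaulay R ∧ ∀ P : Ideal R, P.IsMaximal → typeAt P = 1

end Commutative

section Polynomial

open MvPolynomial

variable {K : Type u} [Field K]

/-- The type of the standard graded algebra `S ⧸ I`, for an ideal `I` of a polynomial ring `S` that
is generated by homogeneous polynomials of positive degree: its type at its homogeneous maximal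
ideal, which is generated by the residue classes of the variables. -/
def gradedType {σ : Type} (I : Ideal (MvPolynomial σ K)) : ℕ∞ :=
  typeAt ((Ideal.span (Set.range (X : σ → MvPolynomial σ K))).map (Ideal.Quotient.mk I))

variable (K) in
/-- The ideal `I_q` of `K[x_1, …, x_n, y_1, …, y_m]` generated by the square-free monomials of
degree `q` in the variables `x_i = X (Sum.inl i)`. -/
def idealX (n m q : ℕ) : Ideal (MvPolynomial (Fin n ⊕ Fin m) K) :=
  Ideal.span {f | ∃ A : Finset (Fin n), A.card = q ∧ f = ∏ i ∈ A, X (Sum.inl i)}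

variable (K) in
/-- The ideal `J_r` of `K[x_1, …, x_n, y_1, …, y_m]` generated by the square-free monomials of
degree `r` in the variables `y_j = X (Sum.inr j)`. -/
def idealY (n m r : ℕ) : Ideal (MvPolynomial (Fin n ⊕ Fin m) K) :=
  Ideal.span {f | ∃ B : Finset (Fin m), B.card = r ∧ f = ∏ j ∈ B, X (Sum.inr j)}

end Polynomial

end MixedProduct

end

namespace MixedProduct

universe u

/-! ### Regular sequences, grade and Ext -/

section Ext

open CategoryTheory RingTheory.Sequence Pointwise

variable {R : Type u} [CommRing R]

/-! Choose sets `A`, `B` of `q - 1` of the `x_i` and `r - 1` of the `y_j`, and look at the point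
with coordinates `1` there and `0` elsewhere. Near it the chosen variables are units, so `I_q J_r`
becomes the intersection of the primes `(x_i : i ∉ A)` and `(y_j : j ∉ B)`. The zero set is then a
union of two linear spaces, of dimensions `m + q - 1` and `n + r - 1`, which meet in dimension only
`q + r - 2`. The depth at the point exceeds that last number by just one: the `X k - 1` for the
chosen variables followed by one `x_i + y_j` form a regular sequence, and modulo it the nonzero
element `x_i` is killed by the maximal ideal (`idealDepth_ker_lift_eval`). The height is at least
the dimension of each linear space (`card_sub_le_height`), so Cohen–Macaulayness forces `m ≤ r` and
`n ≤ q`.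

The ideal is then generated by one nonzero polynomial `f`. Every maximal ideal of the polynomial
ring `S` is generated by a regular sequence (`MaximalIdealsRegular.mvPolynomial`). By Rees'
dimension shifting (`ext_of_isWeaklyRegular`), the Ext group over `S ⧸ (f)` that defines the type is
identified with one over `S` in degree one higher, and that one is `Hom(R ⧸ P, R ⧸ P)`, of length
one (`typeAt_eq_one`). -/

lemma smul_ext_eq_zero {N M : ModuleCat.{u} R} {x : R} (hx : x ∈ Module.annihilator R N) (i : ℕ)
    (e : Abelian.Ext N M i) : x • e = 0 := by
  have h0 : x • 𝟙 N = 0 := by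
    ext y
    exact Module.mem_annihilator.mp hx y
  calc x • e = x • (Abelian.Ext.mk₀ (𝟙 N)).comp e (zero_add i) := by simp
    _ = (Abelian.Ext.mk₀ (x • 𝟙 N)).comp e (zero_add i) := by
        rw [Abelian.Ext.mk₀_smul, Abelian.Ext.smul_comp]
    _ = 0 := by rw [h0]; simp

/-- Dimension shifting along multiplication by a regular element that kills the first argument. -/
lemma nonempty_ext_quotSMulTop_equiv {N : ModuleCat.{u} R} {M : Type u} [AddCommGroup M]
    [Module R M] {x : R} (hx : x ∈ Module.annihilator R N) (hreg : IsSMulRegular M x) (i : ℕ)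
    [Subsingleton (Abelian.Ext N (ModuleCat.of R M) i)] :
    Nonempty (Abelian.Ext N (ModuleCat.of R (QuotSMulTop x M)) i ≃ₗ[R]
      Abelian.Ext N (ModuleCat.of R M) (i + 1)) := by
  have hS : (ModuleCat.smulShortComplex (ModuleCat.of R M) x).ShortExact :=
    IsSMulRegular.smulShortComplex_shortExact (M := ModuleCat.of R M) hreg
  -- The connecting map of the long exact sequence is injective because `Ext^i(N, M)` vanishes, and
  -- surjective because `x` acts as zero on `Ext^(i+1)(N, M)`.
  refine ⟨LinearEquiv.ofBijective (hS.extClass.postcompOfLinear R N (rfl : i + 1 = i + 1)) ⟨?_, ?_⟩⟩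
  · rw [injective_iff_map_eq_zero]
    intro a ha
    obtain ⟨b, hb⟩ := Abelian.Ext.covariant_sequence_exact₃ N hS a rfl ha
    have : b = 0 := Subsingleton.elim (α := Abelian.Ext N (ModuleCat.of R M) i) b 0
    rw [← hb, this]
    simp
  · intro b
    refine Abelian.Ext.covariant_sequence_exact₁ N hS b ?_ rfl
    exact (Abelian.Ext.smul_eq_comp_mk₀ (Y := ModuleCat.of R M) b x).symm.trans
      (smul_ext_eq_zero hx _ b)

/-- Rees' lemma: each term of the sequence kills `N`, so dividing `M` by it lowers the Ext degree by
one, until only Hom is left. -/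
lemma ext_of_isWeaklyRegular {N : ModuleCat.{u} R} (rs : List R) (M : Type u) [AddCommGroup M]
    [Module R M] (hN : ∀ x ∈ rs, x ∈ Module.annihilator R N) (hreg : IsWeaklyRegular M rs) :
    (∀ i < rs.length, Subsingleton (Abelian.Ext N (ModuleCat.of R M) i)) ∧
      Nonempty (Abelian.Ext N (ModuleCat.of R M) rs.length ≃ₗ[R]
        (N →ₗ[R] M ⧸ (Ideal.ofList rs • ⊤ : Submodule R M))) := by
  induction rs generalizing M with
  | nil =>
    refine ⟨by simp, ⟨(Abelian.Ext.linearEquiv₀ (R := R)).trans (ModuleCat.homLinearEquiv.trans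
      (LinearEquiv.congrRight (Submodule.quotEquivOfEqBot _ (by simp)).symm))⟩⟩
  | cons x rs ih =>
    rw [isWeaklyRegular_cons_iff] at hreg
    have hx := hN x (by simp)
    obtain ⟨h1, ⟨e⟩⟩ := ih (QuotSMulTop x M) (fun y hy => hN y (by simp [hy])) hreg.2
    have h0 : Subsingleton (Abelian.Ext N (ModuleCat.of R M) 0) := by
      have := IsSMulRegular.linearMap_subsingleton_of_mem_annihilator hreg.1 hx
      exact ((Abelian.Ext.addEquiv₀ (X := N) (Y := ModuleCat.of R M)).trans
        ModuleCat.homAddEquiv).subsingleton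
    have hlt : ∀ i < (x :: rs).length, Subsingleton (Abelian.Ext N (ModuleCat.of R M) i) := by
      intro i
      induction i with
      | zero => exact fun _ => h0
      | succ i hi =>
        intro hlt
        rw [List.length_cons] at hlt hi
        have := hi (by omega)
        obtain ⟨e'⟩ := nonempty_ext_quotSMulTop_equiv (M := M) hx hreg.1 i
        have := h1 i (by omega)
        exact e'.symm.toEquiv.subsingleton
    refine ⟨hlt, ?_⟩
    have := hlt rs.length (by simp)
    obtain ⟨e'⟩ := nonempty_ext_quotSMulTop_equiv (M := M) hx hreg.1 rs.length
    exact ⟨e'.symm.trans (e.trans (LinearEquiv.congrRight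
      (Submodule.quotOfListConsSMulTopEquivQuotSMulTopInner M x rs).symm))⟩

lemma mem_annihilator_quotient {P : Ideal R} {x : R} (hx : x ∈ P) :
    x ∈ Module.annihilator R (R ⧸ P) := by
  rwa [Ideal.annihilator_quotient]

/-- A regular sequence `bs` on `M` that kills `N` bounds the length of any other one, provided that
there is a nonzero homomorphism from `N` to `M` modulo `bs`. -/
lemma length_le_of_nontrivial_hom {N : ModuleCat.{u} R} {as bs : List R} {M : Type u}
    [AddCommGroup M] [Module R M]
    (ha : ∀ x ∈ as, x ∈ Module.annihilator R N) (haM : IsWeaklyRegular M as)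
    (hb : ∀ x ∈ bs, x ∈ Module.annihilator R N) (hbM : IsWeaklyRegular M bs)
    (hbN : Nontrivial (N →ₗ[R] M ⧸ (Ideal.ofList bs • ⊤ : Submodule R M))) :
    as.length ≤ bs.length := by
  by_contra! hlt
  have := (ext_of_isWeaklyRegular as M ha haM).1 _ hlt
  obtain ⟨e⟩ := (ext_of_isWeaklyRegular bs M hb hbM).2
  have := e.symm.toEquiv.subsingleton
  exact not_subsingleton _ this

/-- The element `s` is a nonzero socle element modulo `rs`; sending `1` to `s` is a nonzero map from
`R ⧸ P`, which prevents any regular sequence in `P` from being longer. -/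
lemma idealDepth_eq_length {P : Ideal R} {rs : List R} (hP : ∀ x ∈ rs, x ∈ P)
    (hreg : IsWeaklyRegular R rs) {s : R} (hs : s ∉ Ideal.ofList rs)
    (hPs : ∀ x ∈ P, x * s ∈ Ideal.ofList rs) : idealDepth P = rs.length := by
  apply le_antisymm
  · refine iSup_le fun as => iSup_le fun ha => iSup_le fun hreg' => ?_
    rw [Nat.cast_le]
    refine length_le_of_nontrivial_hom (N := ModuleCat.of R (R ⧸ P))
      (fun x hx => mem_annihilator_quotient (ha x hx)) hreg'.toIsWeaklyRegular
      (fun x hx => mem_annihilator_quotient (hP x hx)) hreg ⟨⟨0, ?_⟩⟩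
    refine ⟨Submodule.liftQ P (LinearMap.toSpanSingleton R _
      (Submodule.Quotient.mk (p := Ideal.ofList rs • (⊤ : Submodule R R)) s)) ?_, ?_⟩
    · intro x hx
      rw [LinearMap.mem_ker, LinearMap.toSpanSingleton_apply, ← Submodule.Quotient.mk_smul,
        Submodule.Quotient.mk_eq_zero]
      simpa using hPs x hx
    · intro h
      have := LinearMap.congr_fun h (Submodule.Quotient.mk 1)
      erw [Submodule.liftQ_apply] at this
      rw [LinearMap.toSpanSingleton_apply, one_smul, LinearMap.zero_apply, eq_comm,
        Submodule.Quotient.mk_eq_zero] at this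
      exact hs (by simpa using this)
  · refine le_iSup_of_le rs (le_iSup_of_le hP (le_iSup_of_le ⟨hreg, fun h => hs ?_⟩ le_rfl))
    have : s ∈ (⊤ : Submodule R R) := trivial
    rw [h] at this
    simpa using this

lemma exists_isRegular_length_eq_toNat {P : Ideal R} [Nontrivial R] (h : idealDepth P ≠ ⊤) :
    ∃ rs : List R, (∀ x ∈ rs, x ∈ P) ∧ IsRegular R rs ∧ rs.length = (idealDepth P).toNat := by
  obtain ⟨t, ht⟩ := ENat.ne_top_iff_exists.mp h
  rw [← ht, ENat.toNat_natCast]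
  rcases t with _ | t
  · exact ⟨[], by simp, IsRegular.nil R R, rfl⟩
  · have hlt : (t : ℕ∞) < idealDepth P := by
      rw [← ht]
      exact_mod_cast Nat.lt_succ_self t
    simp only [idealDepth, lt_iSup_iff] at hlt
    obtain ⟨rs, hP, hreg, hlt⟩ := hlt
    have hle : (rs.length : ℕ∞) ≤ idealDepth P :=
      le_iSup_of_le rs (le_iSup_of_le hP (le_iSup_of_le hreg le_rfl))
    rw [← ht] at hle
    norm_cast at hlt hle
    exact ⟨rs, hP, hreg, by omega⟩

/-- A regular sequence of maximal length makes all lower Ext groups vanish. If this one vanished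
too, the converse half of Rees' theorem would produce a regular sequence in `P` with one more term.
-/
lemma nontrivial_ext_toNat_idealDepth [IsNoetherianRing R] {P : Ideal R} [hP : P.IsMaximal]
    (h : idealDepth P ≠ ⊤) :
    Nontrivial (Abelian.Ext (ModuleCat.of R (R ⧸ P)) (ModuleCat.of R R) (idealDepth P).toNat) := by
  have : Nontrivial R := ⟨0, 1, fun h => hP.ne_top
    ((Ideal.eq_top_iff_one P).mpr (h ▸ P.zero_mem))⟩
  obtain ⟨rs, hrs, hreg, hlen⟩ := exists_isRegular_length_eq_toNat h
  by_contra hsub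
  rw [not_nontrivial_iff_subsingleton] at hsub
  have hext := (ext_of_isWeaklyRegular (N := ModuleCat.of R (R ⧸ P)) rs R
    (fun x hx => mem_annihilator_quotient (hrs x hx)) hreg.toIsWeaklyRegular).1
  have : Module.Finite R (ModuleCat.of R R) := inferInstanceAs (Module.Finite R R)
  have : Module.Finite R (ModuleCat.of R (R ⧸ P)) := inferInstanceAs (Module.Finite R (R ⧸ P))
  obtain ⟨as, hlen', has, hreg'⟩ := ModuleCat.exists_isRegular_of_exists_subsingleton_ext P
    ((idealDepth P).toNat + 1) (ModuleCat.of R R)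
    (by
      rw [lt_top_iff_ne_top]
      intro h
      exact hP.ne_top (by simpa using h)) (ModuleCat.of R (R ⧸ P))
    (by
      change Module.support R (R ⧸ P) = _
      rw [Module.support_eq_zeroLocus, Ideal.annihilator_quotient])
    (fun i hi => by
      rcases Nat.lt_succ_iff_lt_or_eq.mp hi with h | h
      · exact hext i (hlen ▸ h)
      · exact h ▸ hsub)
  have hle : (as.length : ℕ∞) ≤ idealDepth P :=
    le_iSup_of_le as (le_iSup_of_le has (le_iSup_of_le hreg' le_rfl))
  rw [hlen', ← ENat.natCast_toNat h] at hle
  norm_cast at hle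
  simp at hle

/-! ### The type of a hypersurface ring -/

section Hypersurface

variable {S : Type u} [CommRing S] [Algebra S R] {f : S}

lemma isWeaklyRegular_cons_iff_of_surjective (hsurj : Function.Surjective (algebraMap S R))
    (hf : IsSMulRegular S f) (hker : RingHom.ker (algebraMap S R) = Ideal.span {f})
    (rs : List S) :
    IsWeaklyRegular S (f :: rs) ↔ IsWeaklyRegular R (rs.map (algebraMap S R)) := by
  rw [isWeaklyRegular_cons_iff, and_iff_right hf, isWeaklyRegular_map_algebraMap_iff]
  have hk : f • (⊤ : Submodule S S) = LinearMap.ker (Algebra.linearMap S R) := by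
    rw [← Submodule.ideal_span_singleton_smul, ← hker]
    ext x
    simp
  exact ((Submodule.quotEquivOfEq _ _ hk).trans ((Algebra.linearMap S R).quotKerEquivOfSurjective
    hsurj)).isWeaklyRegular_congr rs

lemma nonempty_quotient_equiv_of_surjective (hsurj : Function.Surjective (algebraMap S R))
    {J : Ideal S} {I : Ideal R} (h : I.comap (algebraMap S R) = J) :
    Nonempty ((S ⧸ (J • ⊤ : Submodule S S)) ≃ₗ[S] R ⧸ I) := by
  have hk : (J • ⊤ : Submodule S S) = LinearMap.ker (Algebra.linearMap S (R ⧸ I)) := by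
    ext x
    rw [LinearMap.mem_ker, Algebra.linearMap_apply, IsScalarTower.algebraMap_apply S R (R ⧸ I),
      Ideal.Quotient.algebraMap_eq, Ideal.Quotient.eq_zero_iff_mem, ← Ideal.mem_comap, h]
    simp
  refine ⟨(Submodule.quotEquivOfEq _ _ hk).trans
    ((Algebra.linearMap S (R ⧸ I)).quotKerEquivOfSurjective ?_)⟩
  exact Ideal.Quotient.mk_surjective.comp hsurj

/-- The type of a hypersurface ring at `P` is `1` if the preimage of `P` in the ambient ring is
generated by a regular sequence. -/
lemma typeAt_eq_one [IsNoetherianRing R]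
    (hsurj : Function.Surjective (algebraMap S R)) (hf : IsSMulRegular S f)
    (hker : RingHom.ker (algebraMap S R) = Ideal.span {f}) (P : Ideal R) [hP : P.IsMaximal]
    {gs : List S} (hgs : IsWeaklyRegular S gs)
    (hgsP : P.comap (algebraMap S R) = Ideal.ofList gs) : typeAt P = 1 := by
  have : Nontrivial R := ⟨0, 1, fun h => hP.ne_top
    ((Ideal.eq_top_iff_one P).mpr (h ▸ P.zero_mem))⟩
  obtain ⟨e⟩ := nonempty_quotient_equiv_of_surjective hsurj hgsP
  have hann : ∀ x ∈ P.comap (algebraMap S R), x ∈ Module.annihilator S (R ⧸ P) := by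
    intro x hx
    rw [Module.mem_annihilator]
    intro y
    rw [← algebraMap_smul R x y]
    exact Module.mem_annihilator.mp (mem_annihilator_quotient (Ideal.mem_comap.mp hx)) y
  have hgann : ∀ x ∈ gs, x ∈ Module.annihilator S (R ⧸ P) := fun x hx =>
    hann x (hgsP ▸ Ideal.subset_span hx)
  have hfP : f ∈ P.comap (algebraMap S R) := by
    have : f ∈ RingHom.ker (algebraMap S R) := hker ▸ Ideal.mem_span_singleton_self f
    rw [RingHom.mem_ker] at this
    rw [Ideal.mem_comap, this]
    exact P.zero_mem
  have hrann : ∀ rs : List S, (∀ x ∈ rs.map (algebraMap S R), x ∈ P) →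
      ∀ x ∈ f :: rs, x ∈ Module.annihilator S (R ⧸ P) := by
    intro rs hrs x hx
    rcases List.mem_cons.mp hx with rfl | hx
    · exact hann _ hfP
    · exact hann _ (hrs _ (List.mem_map_of_mem hx))
  have hlift : Function.Surjective (List.map (algebraMap S R)) :=
    List.map_surjective_iff.mpr hsurj
  -- Prepending `f` to a lift of an `R`-regular sequence gives an `S`-regular sequence. The bound
  -- comes from `gs`, because `S ⧸ (gs)` is `R ⧸ P` and so receives a nonzero map from it.
  have hle : ∀ rs : List S, (∀ x ∈ rs.map (algebraMap S R), x ∈ P) →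
      IsWeaklyRegular R (rs.map (algebraMap S R)) → rs.length + 1 ≤ gs.length := by
    intro rs hrs hreg
    have hnt : Nontrivial ((R ⧸ P) →ₗ[S] S ⧸ (Ideal.ofList gs • ⊤ : Submodule S S)) := by
      refine ⟨⟨0, e.symm.toLinearMap, fun h => ?_⟩⟩
      have h1 := LinearMap.congr_fun h 1
      rw [LinearMap.zero_apply, eq_comm] at h1
      exact one_ne_zero (e.symm.map_eq_zero_iff.mp h1)
    exact length_le_of_nontrivial_hom (N := ModuleCat.of S (R ⧸ P)) (M := S) (hrann rs hrs)
      ((isWeaklyRegular_cons_iff_of_surjective hsurj hf hker rs).mpr hreg) hgann hgs hnt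
  have hfin : idealDepth P ≠ ⊤ := by
    refine ne_top_of_le_ne_top (ENat.natCast_ne_top gs.length)
      (iSup_le fun as => iSup_le fun ha => iSup_le fun hreg => ?_)
    obtain ⟨rs, rfl⟩ := hlift as
    have := hle rs ha hreg.toIsWeaklyRegular
    rw [List.length_map, Nat.cast_le]
    omega
  have hnt := nontrivial_ext_toNat_idealDepth hfin
  obtain ⟨as, has, hreg, hlen⟩ := exists_isRegular_length_eq_toNat hfin
  obtain ⟨rs, rfl⟩ := hlift as
  obtain ⟨e₁⟩ := (ext_of_isWeaklyRegular (N := ModuleCat.of R (R ⧸ P)) _ R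
    (fun x hx => mem_annihilator_quotient (has x hx)) hreg.toIsWeaklyRegular).2
  have hcomap : Ideal.comap (algebraMap S R)
      (Ideal.ofList (rs.map (algebraMap S R)) • ⊤ : Submodule R R) = Ideal.ofList (f :: rs) := by
    rw [smul_eq_mul, Ideal.mul_top, ← Ideal.map_ofList, Ideal.comap_map_of_surjective _ hsurj,
      ← RingHom.ker_eq_comap_bot, hker, Ideal.ofList_cons, sup_comm]
  obtain ⟨e₂⟩ := nonempty_quotient_equiv_of_surjective hsurj hcomap
  have e₃ : ((R ⧸ P) →ₗ[R] R ⧸ (Ideal.ofList (rs.map (algebraMap S R)) • ⊤ : Submodule R R)) ≃ₗ[S]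
      ((R ⧸ P) →ₗ[S] S ⧸ (Ideal.ofList (f :: rs) • ⊤ : Submodule S S)) :=
    (LinearMap.extendScalarsOfSurjectiveEquiv hsurj).symm.trans (LinearEquiv.congrRight e₂.symm)
  have hnt' : Nontrivial ((R ⧸ P) →ₗ[S] S ⧸ (Ideal.ofList (f :: rs) • ⊤ : Submodule S S)) := by
    rw [← hlen] at hnt
    exact (e₁.toEquiv.trans e₃.toEquiv).symm.nontrivial
  have hreg' := (isWeaklyRegular_cons_iff_of_surjective hsurj hf hker rs).mpr
    hreg.toIsWeaklyRegular
  -- The nonvanishing of the Ext group in degree `idealDepth P` gives the reverse inequality, so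
  -- both sequences compute the same Ext group over `S`.
  have hlen' : (f :: rs).length = gs.length :=
    le_antisymm (hle rs has hreg.toIsWeaklyRegular)
      (length_le_of_nontrivial_hom (N := ModuleCat.of S (R ⧸ P)) (M := S) hgann hgs
        (hrann rs has) hreg' hnt')
  obtain ⟨e₄⟩ := (ext_of_isWeaklyRegular (N := ModuleCat.of S (R ⧸ P)) _ S (hrann rs has) hreg').2
  obtain ⟨e₅⟩ := (ext_of_isWeaklyRegular (N := ModuleCat.of S (R ⧸ P)) _ S hgann hgs).2
  rw [hlen'] at e₄
  have e₆ : ((R ⧸ P) →ₗ[S] S ⧸ (Ideal.ofList gs • ⊤ : Submodule S S)) ≃ₗ[S] R ⧸ P :=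
    (LinearEquiv.congrRight e).trans
      ((LinearMap.extendScalarsOfSurjectiveEquiv (R := S) (S := R ⧸ P)
        (Ideal.Quotient.mk_surjective.comp hsurj)).trans
        ((LinearMap.ringLmapEquivSelf (R ⧸ P) S (R ⧸ P))))
  rw [typeAt, ← hlen, e₁.length_eq]
  calc Module.length R
        ((R ⧸ P) →ₗ[R] R ⧸ (Ideal.ofList (rs.map (algebraMap S R)) • ⊤ : Submodule R R))
      = Module.length S ((R ⧸ P) →ₗ[S] S ⧸ (Ideal.ofList (f :: rs) • ⊤ : Submodule S S)) := by
        rw [← Module.length_eq_of_surjective (S := S) hsurj, e₃.length_eq]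
    _ = Module.length S ((R ⧸ P) →ₗ[S] S ⧸ (Ideal.ofList gs • ⊤ : Submodule S S)) :=
        (e₄.symm.trans e₅).length_eq
    _ = Module.length R (R ⧸ P) := by
        rw [e₆.length_eq, Module.length_eq_of_surjective (S := S) hsurj]
    _ = 1 := Module.length_eq_one_iff.mpr (isSimpleModule_iff_isCoatom.mpr hP.out)

end Hypersurface

end Ext

/-! ### Maximal ideals of polynomial rings over a field -/

section RegularRing

open RingTheory.Sequence

/-- Every maximal ideal is generated by a regular sequence. -/
def MaximalIdealsRegular (A : Type*) [CommRing A] : Prop :=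
  ∀ Q : Ideal A, Q.IsMaximal → ∃ gs : List A, IsWeaklyRegular A gs ∧ Ideal.ofList gs = Q

lemma MaximalIdealsRegular.of_ringEquiv {A B : Type*} [CommRing A] [CommRing B] (e : A ≃+* B)
    (h : MaximalIdealsRegular A) : MaximalIdealsRegular B := by
  intro Q hQ
  obtain ⟨gs, hgs, hgsQ⟩ := h (Q.comap e) (Ideal.comap_isMaximal_of_equiv e)
  refine ⟨gs.map e, ?_, ?_⟩
  · exact ((AddEquiv.isWeaklyRegular_congr (e := e.toAddEquiv) <|
      List.forall₂_map_right_iff.mpr <| List.forall₂_same.mpr fun r _ x => map_mul e r x)).mp hgs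
  · have := Ideal.map_ofList (e : A →+* B) gs
    rw [hgsQ] at this
    rw [← Ideal.map_comap_of_surjective (e : A →+* B) e.surjective Q]
    exact this.symm

lemma MaximalIdealsRegular.of_field (A : Type*) [Field A] : MaximalIdealsRegular A := fun Q hQ =>
  ⟨[], IsWeaklyRegular.nil A A, by
    rw [Ideal.ofList_nil]
    exact ((Ideal.eq_bot_or_top Q).resolve_right hQ.ne_top).symm⟩

open Polynomial in
-- The contraction of `Q` to `A` is maximal by the Jacobson property, and its regular generators
-- stay regular in `A[X]` by flatness. Modulo them `Q` lies in a polynomial ring over a field, where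
-- one more generator suffices.
lemma MaximalIdealsRegular.polynomial {A : Type*} [CommRing A] [IsJacobsonRing A]
    (h : MaximalIdealsRegular A) : MaximalIdealsRegular A[X] := by
  intro Q hQ
  have hmax : (Q.comap (C : A →+* A[X])).IsMaximal :=
    Polynomial.isMaximal_comap_C_of_isJacobsonRing Q
  obtain ⟨gs, hgs, hgsQ⟩ := h _ hmax
  let k := A ⧸ Q.comap (C : A →+* A[X])
  let _ : Field k := Ideal.Quotient.field _
  let φ : A[X] →+* k[X] := mapRingHom (Ideal.Quotient.mk _)
  have hφ : Function.Surjective φ := Polynomial.map_surjective _ Ideal.Quotient.mk_surjective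
  have hker : RingHom.ker φ = Ideal.ofList (gs.map (C : A →+* A[X])) := by
    rw [← Ideal.map_ofList, hgsQ, Polynomial.ker_mapRingHom, Ideal.mk_ker]
  have hkerQ : RingHom.ker φ ≤ Q := by
    rw [hker, ← Ideal.map_ofList, hgsQ]
    exact Ideal.map_comap_le
  have hreg : IsWeaklyRegular A[X] (gs.map (C : A →+* A[X])) :=
    IsWeaklyRegular.of_flat (S := A[X]) hgs
  obtain ⟨h', hh'⟩ := (IsPrincipalIdealRing.principal (Q.map φ)).principal
  obtain ⟨h, rfl⟩ := hφ h'
  have hQeq : Q = RingHom.ker φ ⊔ Ideal.span {h} := by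
    have h1 : (Q.map φ).comap φ = Q := by
      rw [Ideal.comap_map_of_surjective _ hφ, ← RingHom.ker_eq_comap_bot, sup_eq_left.mpr hkerQ]
    have h2 : Q.map φ = (Ideal.span {h}).map φ := by
      rw [hh', Ideal.map_span, Set.image_singleton]
    refine h1.symm.trans ?_
    rw [h2, Ideal.comap_map_of_surjective _ hφ, ← RingHom.ker_eq_comap_bot, sup_comm]
  -- There is no need to exclude a zero image: the last generator is then superfluous.
  by_cases h0 : φ h = 0
  · refine ⟨_, hreg, ?_⟩
    rw [hQeq, ← hker, left_eq_sup, Ideal.span_singleton_le_iff_mem]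
    exact h0
  · refine ⟨gs.map (C : A →+* A[X]) ++ [h], ?_, ?_⟩
    · rw [isWeaklyRegular_append_iff, isWeaklyRegular_singleton_iff]
      refine ⟨hreg, ?_⟩
      rw [isSMulRegular_iff_right_eq_zero_of_smul]
      intro x hx
      obtain ⟨x, rfl⟩ := Submodule.Quotient.mk_surjective _ x
      rw [← Submodule.Quotient.mk_smul, Submodule.Quotient.mk_eq_zero, smul_eq_mul, smul_eq_mul,
        Ideal.mul_top, ← hker, RingHom.mem_ker, map_mul] at hx
      rw [Submodule.Quotient.mk_eq_zero, smul_eq_mul, Ideal.mul_top, ← hker]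
      exact (mul_eq_zero.mp hx).resolve_left h0
    · rw [Ideal.ofList_append, ← hker, Ideal.ofList_singleton, ← hQeq]

lemma MaximalIdealsRegular.mvPolynomial (K : Type u) [Field K] (σ : Type*) [Finite σ] :
    MaximalIdealsRegular (MvPolynomial σ K) := by
  induction σ using Finite.induction_empty_option with
  | of_equiv e h => exact h.of_ringEquiv (MvPolynomial.renameEquiv K e).toRingEquiv
  | h_empty =>
    exact (MaximalIdealsRegular.of_field K).of_ringEquiv
      (MvPolynomial.isEmptyRingEquiv K PEmpty).symm
  | h_option h =>
    exact h.polynomial.of_ringEquiv (MvPolynomial.optionEquivLeft K _).toRingEquiv.symm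

end RegularRing

/-! ### Regular sequences in quotient rings -/

section Quotient

open RingTheory.Sequence MvPolynomial Pointwise

variable {S : Type*} [CommRing S] {I J : Ideal S}

lemma mk_mem_map_mk_iff {f : S} :
    Ideal.Quotient.mk I f ∈ J.map (Ideal.Quotient.mk I) ↔ f ∈ I ⊔ J := by
  rw [← Ideal.mem_comap, Ideal.comap_map_of_surjective _ Ideal.Quotient.mk_surjective,
    ← RingHom.ker_eq_comap_bot, Ideal.mk_ker, sup_comm]

lemma isWeaklyRegular_map_mk_concat {rs : List S} {x : S}
    (hrs : IsWeaklyRegular (S ⧸ I) (rs.map (Ideal.Quotient.mk I)))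
    (hx : ∀ f, x * f ∈ I ⊔ Ideal.ofList rs → f ∈ I ⊔ Ideal.ofList rs) :
    IsWeaklyRegular (S ⧸ I) ((rs ++ [x]).map (Ideal.Quotient.mk I)) := by
  rw [List.map_append, List.map_singleton, isWeaklyRegular_append_iff,
    isWeaklyRegular_singleton_iff]
  refine ⟨hrs, ?_⟩
  rw [isSMulRegular_iff_right_eq_zero_of_smul]
  intro y hy
  obtain ⟨y, rfl⟩ := Submodule.Quotient.mk_surjective _ y
  obtain ⟨f, rfl⟩ := Ideal.Quotient.mk_surjective y
  rw [← Submodule.Quotient.mk_smul, Submodule.Quotient.mk_eq_zero, smul_eq_mul, smul_eq_mul,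
    Ideal.mul_top, ← Ideal.map_ofList, ← map_mul, mk_mem_map_mk_iff] at hy
  rw [Submodule.Quotient.mk_eq_zero, smul_eq_mul, Ideal.mul_top, ← Ideal.map_ofList,
    mk_mem_map_mk_iff]
  exact hx f hy

end Quotient

/-! ### Monomial ideals and setting variables to one -/

section Specialization

open RingTheory.Sequence MvPolynomial Pointwise

variable {σ K : Type*} [Field K]

/-- Modulo `J` the substitution `g` fixes every variable, hence every polynomial. -/
lemma sub_aeval_mem {J : Ideal (MvPolynomial σ K)} {g : σ → MvPolynomial σ K}
    (hg : ∀ i, X i - g i ∈ J) (f : MvPolynomial σ K) : f - aeval g f ∈ J := by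
  have h : (Ideal.Quotient.mkₐ K J).comp (aeval g) = Ideal.Quotient.mkₐ K J := by
    ext i
    simpa using (Ideal.Quotient.eq.mpr (hg i)).symm
  exact Ideal.Quotient.eq.mp (DFunLike.congr_fun h f).symm

lemma mem_span_X_image_iff_aeval_eq_zero {s : Set σ} [DecidablePred (· ∈ s)]
    {f : MvPolynomial σ K} :
    f ∈ Ideal.span (X '' s : Set (MvPolynomial σ K)) ↔
      aeval (fun i => if i ∈ s then (0 : MvPolynomial σ K) else X i) f = 0 := by
  refine ⟨fun h => ?_, fun h => ?_⟩
  · rw [← AlgHom.coe_toRingHom, ← RingHom.mem_ker]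
    refine Ideal.span_le.mpr ?_ h
    rintro _ ⟨i, hi, rfl⟩
    simp [RingHom.mem_ker, hi]
  · have := sub_aeval_mem (J := Ideal.span (X '' s : Set (MvPolynomial σ K)))
      (g := fun i => if i ∈ s then (0 : MvPolynomial σ K) else X i) (fun i => ?_) f
    · rwa [h, sub_zero] at this
    · by_cases hi : i ∈ s
      · simpa [hi] using Ideal.subset_span (Set.mem_image_of_mem X hi)
      · simp [hi]

/-- An ideal generated by monomials. -/
def IsMonomialIdeal (J : Ideal (MvPolynomial σ K)) : Prop :=
  ∃ G : Set (MvPolynomial σ K),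
    G ⊆ (Submonoid.closure (Set.range X) : Submonoid (MvPolynomial σ K)) ∧ J = Ideal.span G

lemma exists_eq_monomial_of_mem_closure {p : MvPolynomial σ K}
    (hp : p ∈ Submonoid.closure (Set.range X)) : ∃ d, monomial d 1 = p := by
  induction hp using Submonoid.closure_induction with
  | mem x hx =>
    obtain ⟨i, rfl⟩ := hx
    exact ⟨Finsupp.single i 1, rfl⟩
  | one => exact ⟨0, rfl⟩
  | mul x y _ _ hx hy =>
    obtain ⟨a, rfl⟩ := hx
    obtain ⟨b, rfl⟩ := hy
    exact ⟨a + b, by simp [monomial_mul]⟩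

lemma IsMonomialIdeal.mul {I J : Ideal (MvPolynomial σ K)} (hI : IsMonomialIdeal I)
    (hJ : IsMonomialIdeal J) : IsMonomialIdeal (I * J) := by
  obtain ⟨G, hG, rfl⟩ := hI
  obtain ⟨H, hH, rfl⟩ := hJ
  refine ⟨G * H, ?_, Ideal.span_mul_span' G H⟩
  rintro _ ⟨a, ha, b, hb, rfl⟩
  exact mul_mem (hG ha) (hH hb)

/-- A polynomial `X j - 1` is regular modulo a monomial ideal. -/
lemma IsMonomialIdeal.mem_of_X_sub_one_mul_mem {J : Ideal (MvPolynomial σ K)}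
    (hJ : IsMonomialIdeal J) {j : σ} {f : MvPolynomial σ K} (hf : (X j - 1) * f ∈ J) : f ∈ J := by
  classical
  obtain ⟨G, hG, rfl⟩ := hJ
  have hG' : (fun d => monomial d (1 : K)) '' {d | monomial d 1 ∈ G} = G := by
    ext p
    constructor
    · rintro ⟨d, hd, rfl⟩
      exact hd
    · intro hp
      obtain ⟨d, rfl⟩ := exists_eq_monomial_of_mem_closure (hG hp)
      exact ⟨d, hp, rfl⟩
  rw [← hG', mem_ideal_span_monomial_image] at hf ⊢
  by_contra! hcon
  -- Take `d` minimal among the exponents of `f` outside the ideal. By minimality `X j * f`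
  -- contributes nothing at `d`, so `d` survives in `(X j - 1) * f`.
  obtain ⟨d, hd, hmin⟩ := exists_minimal_of_wellFoundedLT
    (fun d => d ∈ f.support ∧ ∀ e ∈ {d | monomial d 1 ∈ G}, ¬ e ≤ d) hcon
  obtain ⟨e, he, hed⟩ := hf d (by
    rw [mem_support_iff, sub_mul, one_mul, coeff_sub, coeff_X_mul']
    split_ifs with hj
    · have h0 : coeff (d - Finsupp.single j 1) f = 0 := by
        by_contra hne
        have hle : d - Finsupp.single j 1 ≤ d := tsub_le_self
        have := hmin ⟨mem_support_iff.mpr hne, fun e he h => hd.2 e he (h.trans hle)⟩ hle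
        have := this j
        simp only [Finsupp.coe_tsub, Pi.sub_apply, Finsupp.single_eq_same] at this
        have := Finsupp.mem_support_iff.mp hj
        omega
      simpa [h0] using hd.1
    · simpa using hd.1)
  exact hd.2 e he hed

open Classical in
/-- The specialization of the variables in a list to `1`. -/
noncomputable def specialize (l : List σ) : MvPolynomial σ K →ₐ[K] MvPolynomial σ K :=
  aeval fun i => if i ∈ l then 1 else X i

@[simp] lemma specialize_X_of_mem {l : List σ} {i : σ} (hi : i ∈ l) :
    specialize l (X i : MvPolynomial σ K) = 1 := by simp [specialize, hi]

@[simp] lemma specialize_X_of_notMem {l : List σ} {i : σ} (hi : i ∉ l) :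
    specialize l (X i : MvPolynomial σ K) = X i := by simp [specialize, hi]

lemma IsMonomialIdeal.map_specialize {J : Ideal (MvPolynomial σ K)} (hJ : IsMonomialIdeal J)
    (l : List σ) : IsMonomialIdeal (J.map (specialize l)) := by
  obtain ⟨G, hG, rfl⟩ := hJ
  refine ⟨specialize l '' G, ?_, Ideal.map_span _ _⟩
  rintro _ ⟨p, hp, rfl⟩
  have : Submonoid.closure (Set.range X) ≤
      (Submonoid.closure (Set.range (X : σ → MvPolynomial σ K))).comap (specialize (K := K) l) := by
    rw [Submonoid.closure_le]
    rintro _ ⟨i, rfl⟩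
    change specialize l (X i) ∈ Submonoid.closure _
    by_cases hi : i ∈ l
    · rw [specialize_X_of_mem hi]
      exact one_mem _
    · rw [specialize_X_of_notMem hi]
      exact Submonoid.subset_closure ⟨i, rfl⟩
  exact this (hG hp)

/-- Membership modulo `X i - 1`, for the variables in a list, is tested by specialization. -/
lemma mem_sup_ofList_X_sub_one_iff {I : Ideal (MvPolynomial σ K)} {l : List σ}
    {f : MvPolynomial σ K} :
    f ∈ I ⊔ Ideal.ofList (l.map fun i => X i - 1) ↔ specialize l f ∈ I.map (specialize l) := by
  have hsub : ∀ g : MvPolynomial σ K,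
      g - specialize l g ∈ I ⊔ Ideal.ofList (l.map fun i => X i - 1) := by
    classical
    refine sub_aeval_mem fun i => ?_
    by_cases hi : i ∈ l
    · rw [if_pos hi]
      exact Ideal.mem_sup_right (Ideal.subset_span
        (List.mem_map_of_mem (f := fun i => (X i - 1 : MvPolynomial σ K)) hi))
    · convert Ideal.zero_mem _
      convert sub_self _
      rw [if_neg hi]
  refine ⟨fun h => ?_, fun h => ?_⟩
  · have h' := Ideal.mem_map_of_mem (specialize (K := K) l) h
    rw [Ideal.map_sup] at h'
    refine (sup_le le_rfl (Ideal.map_le_iff_le_comap.mpr (Ideal.span_le.mpr fun x hx => ?_)) :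
      _ ≤ I.map (specialize l)) h'
    obtain ⟨i, hi, rfl⟩ := List.mem_map.mp hx
    simp [hi]
  · have hle : I.map (specialize l) ≤ I ⊔ Ideal.ofList (l.map fun i => X i - 1) := by
      rw [Ideal.map_le_iff_le_comap]
      intro g hg
      have := sub_mem (Ideal.mem_sup_left hg) (hsub g)
      rwa [sub_sub_cancel] at this
    have := add_mem (hsub f) (hle h)
    rwa [sub_add_cancel] at this

/-- Setting earlier variables to `1` leaves a monomial ideal and fixes the next variable, as the
list has no repetition. Each step is thus the case of a single `X j - 1`. -/
lemma IsMonomialIdeal.isWeaklyRegular_X_sub_one {I : Ideal (MvPolynomial σ K)}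
    (hI : IsMonomialIdeal I) {l : List σ} (hl : l.Nodup) :
    IsWeaklyRegular (MvPolynomial σ K ⧸ I)
      ((l.map fun i => X i - 1).map (Ideal.Quotient.mk I)) := by
  induction l using List.reverseRecOn with
  | nil => exact IsWeaklyRegular.nil _ _
  | append_singleton l j ih =>
    rw [List.nodup_append] at hl
    rw [List.map_append, List.map_singleton]
    refine isWeaklyRegular_map_mk_concat (ih hl.1) fun f hf => ?_
    have hj : j ∉ l := fun hj => hl.2.2 j hj j (by simp) rfl
    rw [mem_sup_ofList_X_sub_one_iff] at hf ⊢
    rw [map_mul, map_sub, map_one, specialize_X_of_notMem hj] at hf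
    exact (hI.map_specialize l).mem_of_X_sub_one_mul_mem hf

end Specialization

/-! ### A lower bound for the height of a point -/

section Height

open RingTheory.Sequence MvPolynomial Pointwise

variable {σ K : Type*} [Field K]

open Classical in
/-- The evaluation of the variables in a finite set at the coordinates of a point. -/
noncomputable def partialEval (a : σ → K) (T : Finset σ) :
    MvPolynomial σ K →ₐ[K] MvPolynomial σ K :=
  aeval fun i => if i ∈ T then C (a i) else X i

lemma partialEval_X_of_mem (a : σ → K) {T : Finset σ} {i : σ} (hi : i ∈ T) :
    partialEval a T (X i) = C (a i) := by simp [partialEval, hi]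

lemma partialEval_X_of_notMem (a : σ → K) {T : Finset σ} {i : σ} (hi : i ∉ T) :
    partialEval a T (X i) = X i := by simp [partialEval, hi]

lemma partialEval_comp (a : σ → K) {T T' : Finset σ} (h : T ⊆ T') :
    (partialEval a T').comp (partialEval a T) = partialEval a T' := by
  ext1 i
  by_cases hi : i ∈ T
  · simp [partialEval_X_of_mem a hi, partialEval_X_of_mem a (h hi)]
  · simp [partialEval_X_of_notMem a hi]

lemma partialEval_univ [Fintype σ] (a : σ → K) (f : MvPolynomial σ K) :
    partialEval a Finset.univ f = C (eval a f) := by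
  have : partialEval a Finset.univ = (Algebra.ofId K (MvPolynomial σ K)).comp (aeval a) := by
    ext1 i
    rw [partialEval_X_of_mem a (Finset.mem_univ i)]
    simp [Algebra.ofId_apply, algebraMap_eq]
  rw [this]
  simp [Algebra.ofId_apply, algebraMap_eq, aeval_eq_eval]

/-- If `I` vanishes where the variables in `F` take their values at `a`, then the height of the
ideal of `a` modulo `I` is at least the number of the other variables. -/
lemma card_sub_le_height [Fintype σ] {I : Ideal (MvPolynomial σ K)} {a : σ → K} {F : Finset σ}
    (hF : I ≤ RingHom.ker (partialEval a F)) (hI : ∀ f ∈ I, eval a f = 0) :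
    ((Fintype.card σ - F.card : ℕ) : ℕ∞) ≤
      (RingHom.ker (Ideal.Quotient.lift I (eval a) hI)).height := by
  classical
  have hT : ∀ T, F ⊆ T → ∀ f ∈ I, partialEval a T f = 0 := by
    intro T hFT f hf
    rw [← partialEval_comp a hFT, AlgHom.comp_apply, RingHom.mem_ker.mp (hF hf), map_zero]
  -- Evaluating one more variable at a time gives a strictly increasing chain of primes, the kernels
  -- of `partialEval a T`; `X j - C (a j)` witnesses each strict inclusion.
  have key : ∀ k T (hFT : F ⊆ T), T.card = F.card + k → (k : ℕ∞) ≤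
      (RingHom.ker (Ideal.Quotient.lift I (partialEval a T).toRingHom (hT T hFT))).height := by
    intro k
    induction k with
    | zero => simp
    | succ k ih =>
      intro T hFT hcard
      obtain ⟨j, hjT, hjF⟩ := Finset.exists_mem_notMem_of_card_lt_card
        (show F.card < T.card by omega)
      have hFT' : F ⊆ T.erase j := Finset.subset_erase.mpr ⟨hFT, hjF⟩
      have hp := RingHom.ker_isPrime
        (Ideal.Quotient.lift I (partialEval a T).toRingHom (hT T hFT))
      have hp' := RingHom.ker_isPrime
        (Ideal.Quotient.lift I (partialEval a (T.erase j)).toRingHom (hT _ hFT'))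
      have hlt : RingHom.ker
          (Ideal.Quotient.lift I (partialEval a (T.erase j)).toRingHom (hT _ hFT')) <
          RingHom.ker (Ideal.Quotient.lift I (partialEval a T).toRingHom (hT T hFT)) := by
        refine SetLike.lt_iff_le_and_exists.mpr ⟨fun x hx => ?_,
          Ideal.Quotient.mk I (X j - C (a j)), ?_, ?_⟩
        · obtain ⟨f, rfl⟩ := Ideal.Quotient.mk_surjective x
          rw [RingHom.mem_ker, Ideal.Quotient.lift_mk] at hx ⊢
          change partialEval a (T.erase j) f = 0 at hx
          change partialEval a T f = 0
          rw [← partialEval_comp a (Finset.erase_subset j T), AlgHom.comp_apply, hx, map_zero]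
        · rw [RingHom.mem_ker, Ideal.Quotient.lift_mk]
          change partialEval a T (X j - C (a j)) = 0
          rw [map_sub, partialEval_X_of_mem a hjT, algHom_C, algebraMap_eq, sub_self]
        · rw [RingHom.mem_ker, Ideal.Quotient.lift_mk]
          change partialEval a (T.erase j) (X j - C (a j)) ≠ 0
          rw [map_sub, partialEval_X_of_notMem a (Finset.notMem_erase j T), algHom_C,
            algebraMap_eq]
          intro h
          have := congrArg (coeff (Finsupp.single j 1)) h
          simp [coeff_C, eq_comm (a := (0 : σ →₀ ℕ))] at this
      refine le_trans ?_ (Ideal.height_add_one_le_of_lt_of_isPrime hlt)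
      rw [Nat.cast_succ]
      refine add_le_add_left (ih _ hFT' ?_) 1
      rw [Finset.card_erase_of_mem hjT]
      omega
  have h := key (Fintype.card σ - F.card) Finset.univ (Finset.subset_univ F) (by
    rw [Finset.card_univ, Nat.add_sub_cancel' (Finset.card_le_univ F)])
  refine h.trans_eq (congrArg _ ?_)
  ext x
  obtain ⟨f, rfl⟩ := Ideal.Quotient.mk_surjective x
  rw [RingHom.mem_ker, RingHom.mem_ker, Ideal.Quotient.lift_mk, Ideal.Quotient.lift_mk]
  change partialEval a Finset.univ f = 0 ↔ _
  rw [partialEval_univ, C_eq_zero]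

end Height

/-! ### Depth and height for the ideals `I_q J_r` -/

section MixedProductIdeal

open RingTheory.Sequence MvPolynomial

variable {K : Type u} [Field K] {n m q r : ℕ}

lemma isMonomialIdeal_idealX : IsMonomialIdeal (idealX K n m q) := by
  refine ⟨_, ?_, rfl⟩
  rintro _ ⟨A, -, rfl⟩
  exact prod_mem fun i _ => Submonoid.subset_closure ⟨_, rfl⟩

lemma isMonomialIdeal_idealY : IsMonomialIdeal (idealY K n m r) := by
  refine ⟨_, ?_, rfl⟩
  rintro _ ⟨A, -, rfl⟩
  exact prod_mem fun i _ => Submonoid.subset_closure ⟨_, rfl⟩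

variable {A : Finset (Fin n)} {B : Finset (Fin m)}

lemma idealX_le_of_forall_notMem (hA : A.card < q) {J : Ideal (MvPolynomial (Fin n ⊕ Fin m) K)}
    (hJ : ∀ i ∉ A, X (Sum.inl i) ∈ J) : idealX K n m q ≤ J := by
  refine Ideal.span_le.mpr ?_
  rintro _ ⟨A', hA', rfl⟩
  obtain ⟨i, hi, hiA⟩ := Finset.exists_mem_notMem_of_card_lt_card (hA.trans_eq hA'.symm)
  exact Ideal.mem_of_dvd _ (Finset.dvd_prod_of_mem _ hi) (hJ i hiA)

lemma idealY_le_of_forall_notMem (hB : B.card < r) {J : Ideal (MvPolynomial (Fin n ⊕ Fin m) K)}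
    (hJ : ∀ j ∉ B, X (Sum.inr j) ∈ J) : idealY K n m r ≤ J := by
  refine Ideal.span_le.mpr ?_
  rintro _ ⟨B', hB', rfl⟩
  obtain ⟨j, hj, hjB⟩ := Finset.exists_mem_notMem_of_card_lt_card (hB.trans_eq hB'.symm)
  exact Ideal.mem_of_dvd _ (Finset.dvd_prod_of_mem _ hj) (hJ j hjB)

lemma inl_mem_toList_disjSum {i : Fin n} : Sum.inl i ∈ (A.disjSum B).toList ↔ i ∈ A := by simp

lemma inr_mem_toList_disjSum {j : Fin m} : Sum.inr j ∈ (A.disjSum B).toList ↔ j ∈ B := by simp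

lemma X_mul_X_mem_map_specialize (hA : A.card + 1 = q) (hB : B.card + 1 = r) {i : Fin n}
    {j : Fin m} (hi : i ∉ A) (hj : j ∉ B) :
    X (Sum.inl i) * X (Sum.inr j) ∈
      (idealX K n m q * idealY K n m r).map (specialize (A.disjSum B).toList) := by
  -- Since `A` has `q - 1` elements, adjoining `i` gives a generator of degree `q` that specializes
  -- to the single variable.
  have hx : X (Sum.inl i) = specialize (K := K) (A.disjSum B).toList
      (∏ i ∈ insert i A, X (Sum.inl i)) := by
    rw [map_prod, Finset.prod_insert hi, Finset.prod_eq_one, mul_one, specialize_X_of_notMem]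
    · rwa [inl_mem_toList_disjSum]
    · intro i' hi'
      rw [specialize_X_of_mem]
      rwa [inl_mem_toList_disjSum]
  have hy : X (Sum.inr j) = specialize (K := K) (A.disjSum B).toList
      (∏ j ∈ insert j B, X (Sum.inr j)) := by
    rw [map_prod, Finset.prod_insert hj, Finset.prod_eq_one, mul_one, specialize_X_of_notMem]
    · rwa [inr_mem_toList_disjSum]
    · intro j' hj'
      rw [specialize_X_of_mem]
      rwa [inr_mem_toList_disjSum]
  rw [hx, hy, ← map_mul]
  refine Ideal.mem_map_of_mem _ (Ideal.mul_mem_mul (Ideal.subset_span ⟨_, ?_, rfl⟩)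
    (Ideal.subset_span ⟨_, ?_, rfl⟩))
  · rw [Finset.card_insert_of_notMem hi, hA]
  · rw [Finset.card_insert_of_notMem hj, hB]

/-- After setting `q - 1` of the `x_i` and `r - 1` of the `y_j` to `1`, the ideal `I_q J_r` becomes
the intersection of the prime ideals generated by the other `x_i` and by the other `y_j`. -/
lemma mem_map_specialize_iff (hA : A.card + 1 = q) (hB : B.card + 1 = r)
    {f : MvPolynomial (Fin n ⊕ Fin m) K} :
    f ∈ (idealX K n m q * idealY K n m r).map (specialize (A.disjSum B).toList) ↔
      f ∈ Ideal.span (X '' (Sum.inl '' {i | i ∉ A}) : Set (MvPolynomial (Fin n ⊕ Fin m) K)) ∧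
        f ∈ Ideal.span (X '' (Sum.inr '' {j | j ∉ B}) : Set (MvPolynomial (Fin n ⊕ Fin m) K)) := by
  refine ⟨fun h => ⟨?_, ?_⟩, fun ⟨hx, hy⟩ => ?_⟩
  · refine Ideal.map_le_iff_le_comap.mpr (Ideal.mul_le_left.trans
      (idealX_le_of_forall_notMem (A := A) (by omega) fun i hi => ?_)) h
    rw [Ideal.mem_comap, specialize_X_of_notMem (by rwa [inl_mem_toList_disjSum])]
    exact Ideal.subset_span ⟨_, ⟨i, hi, rfl⟩, rfl⟩
  · refine Ideal.map_le_iff_le_comap.mpr (Ideal.mul_le_right.trans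
      (idealY_le_of_forall_notMem (B := B) (by omega) fun j hj => ?_)) h
    rw [Ideal.mem_comap, specialize_X_of_notMem (by rwa [inr_mem_toList_disjSum])]
    exact Ideal.subset_span ⟨_, ⟨j, hj, rfl⟩, rfl⟩
  · rw [mem_ideal_span_X_image] at hx hy
    rw [f.as_sum]
    refine sum_mem fun d hd => ?_
    obtain ⟨_, ⟨i, hi, rfl⟩, hdi⟩ := hx d hd
    obtain ⟨_, ⟨j, hj, rfl⟩, hdj⟩ := hy d hd
    refine Ideal.mem_of_dvd _ ?_ (X_mul_X_mem_map_specialize hA hB hi hj)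
    have : (X (Sum.inl i) * X (Sum.inr j) : MvPolynomial (Fin n ⊕ Fin m) K) =
        monomial (Finsupp.single (Sum.inl i) 1 + Finsupp.single (Sum.inr j) 1) 1 := by
      rw [X, X, monomial_mul, one_mul]
    rw [this, monomial_dvd_monomial]
    refine ⟨Or.inr ?_, one_dvd _⟩
    intro k
    by_cases h1 : k = Sum.inl i
    · subst h1
      simpa [Nat.one_le_iff_ne_zero] using hdi
    · by_cases h2 : k = Sum.inr j
      · subst h2
        simpa [Nat.one_le_iff_ne_zero] using hdj
      · simp [Ne.symm h1, Ne.symm h2]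

/-- The coordinates of the point with coordinates `1` in two finite sets and `0` elsewhere. -/
noncomputable def indicatorPoint (K : Type u) [Field K] (A : Finset (Fin n)) (B : Finset (Fin m)) :
    Fin n ⊕ Fin m → K :=
  Sum.elim (fun i => if i ∈ A then 1 else 0) (fun j => if j ∈ B then 1 else 0)

lemma eval_indicatorPoint_eq_zero (hA : A.card < q) {f : MvPolynomial (Fin n ⊕ Fin m) K}
    (hf : f ∈ idealX K n m q * idealY K n m r) : eval (indicatorPoint K A B) f = 0 := by
  have : idealX K n m q ≤ RingHom.ker (eval (indicatorPoint K A B)) :=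
    idealX_le_of_forall_notMem hA fun i hi => by simp [RingHom.mem_ker, indicatorPoint, hi]
  exact this (Ideal.mul_le_left hf)

/-- After specialization the ideal is an intersection of two primes, and `x_i + y_j` lies in
neither, so it is a nonzerodivisor. -/
lemma isWeaklyRegular_idealX_mul_idealY (hA : A.card + 1 = q) (hB : B.card + 1 = r) {i : Fin n}
    {j : Fin m} (hi : i ∉ A) (hj : j ∉ B) :
    IsWeaklyRegular (MvPolynomial (Fin n ⊕ Fin m) K ⧸ idealX K n m q * idealY K n m r)
      (((A.disjSum B).toList.map (fun k => (X k - 1 : MvPolynomial _ K)) ++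
        [X (Sum.inl i) + X (Sum.inr j)]).map
        (Ideal.Quotient.mk (idealX K n m q * idealY K n m r))) := by
  classical
  refine isWeaklyRegular_map_mk_concat ((isMonomialIdeal_idealX.mul
    isMonomialIdeal_idealY).isWeaklyRegular_X_sub_one (Finset.nodup_toList _)) fun f hf => ?_
  rw [mem_sup_ofList_X_sub_one_iff] at hf ⊢
  rw [map_mul, map_add, specialize_X_of_notMem (by rwa [inl_mem_toList_disjSum]),
    specialize_X_of_notMem (by rwa [inr_mem_toList_disjSum])] at hf
  rw [mem_map_specialize_iff hA hB, mem_span_X_image_iff_aeval_eq_zero,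
    mem_span_X_image_iff_aeval_eq_zero] at hf ⊢
  simpa [hi, hj, X_ne_zero] using hf

/-- Suppose `x_i = g + p * (x_i + y_j)` after specialization. As `g` lies in both primes, it has no
linear term in `x_i` or `y_j`; comparing these two coefficients makes the constant term of `p` both
`1` and `0`. -/
lemma X_notMem_sup (hA : A.card + 1 = q) (hB : B.card + 1 = r) {i : Fin n}
    {j : Fin m} (hi : i ∉ A) (hj : j ∉ B) :
    (X (Sum.inl i) : MvPolynomial (Fin n ⊕ Fin m) K) ∉ idealX K n m q * idealY K n m r ⊔
      Ideal.ofList ((A.disjSum B).toList.map (fun k => X k - 1) ++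
        [X (Sum.inl i) + X (Sum.inr j)]) := by
  intro h
  rw [Ideal.ofList_append, ← sup_assoc, Ideal.ofList_singleton, Submodule.mem_sup] at h
  obtain ⟨g, hg, h, hh, hgh⟩ := h
  obtain ⟨p, rfl⟩ := Ideal.mem_span_singleton'.mp hh
  rw [mem_sup_ofList_X_sub_one_iff, mem_map_specialize_iff hA hB, mem_ideal_span_X_image,
    mem_ideal_span_X_image] at hg
  have hgh' := congrArg (specialize (A.disjSum B).toList) hgh
  rw [map_add, map_mul, map_add, specialize_X_of_notMem (by rwa [inl_mem_toList_disjSum]),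
    specialize_X_of_notMem (by rwa [inr_mem_toList_disjSum])] at hgh'
  have h1 : coeff (Finsupp.single (Sum.inl i) 1) (specialize (A.disjSum B).toList g) = 0 := by
    by_contra hne
    obtain ⟨_, ⟨k, hk, rfl⟩, hk'⟩ := hg.2 _ (mem_support_iff.mpr hne)
    simp at hk'
  have h2 : coeff (Finsupp.single (Sum.inr j) 1) (specialize (A.disjSum B).toList g) = 0 := by
    by_contra hne
    obtain ⟨_, ⟨k, hk, rfl⟩, hk'⟩ := hg.1 _ (mem_support_iff.mpr hne)
    simp at hk'
  have e1 := congrArg (coeff (Finsupp.single (Sum.inl i) 1)) hgh'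
  have e2 := congrArg (coeff (Finsupp.single (Sum.inr j) 1)) hgh'
  simp [h1, mul_add, coeff_mul_X'] at e1
  simp [h2, mul_add, coeff_mul_X', coeff_X] at e2
  simp [e2] at e1
  exact Sum.inl_ne_inr (Finsupp.single_left_injective one_ne_zero e1)

lemma mul_X_mem_sup (hA : A.card + 1 = q) (hB : B.card + 1 = r) {i : Fin n}
    {j : Fin m} (hi : i ∉ A) (hj : j ∉ B) {f : MvPolynomial (Fin n ⊕ Fin m) K}
    (hf : eval (indicatorPoint K A B) f = 0) :
    f * X (Sum.inl i) ∈ idealX K n m q * idealY K n m r ⊔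
      Ideal.ofList ((A.disjSum B).toList.map (fun k => X k - 1) ++
        [X (Sum.inl i) + X (Sum.inr j)]) := by
  set a := idealX K n m q * idealY K n m r ⊔
      Ideal.ofList ((A.disjSum B).toList.map (fun k => X k - 1) ++
        [X (Sum.inl i) + X (Sum.inr j)]) with ha
  have hle : idealX K n m q * idealY K n m r ⊔
      Ideal.ofList ((A.disjSum B).toList.map (fun k => X k - 1)) ≤ a := by
    rw [ha, Ideal.ofList_append, ← sup_assoc]
    exact le_sup_left
  have hw : X (Sum.inl i) + X (Sum.inr j) ∈ a :=
    Ideal.mem_sup_right (Ideal.subset_span (by simp))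
  have hxy : ∀ i' ∉ A, ∀ j' ∉ B, X (Sum.inl i') * X (Sum.inr j') ∈ a := by
    intro i' hi' j' hj'
    refine hle (mem_sup_ofList_X_sub_one_iff.mpr ?_)
    rw [map_mul, specialize_X_of_notMem (by rwa [inl_mem_toList_disjSum]),
      specialize_X_of_notMem (by rwa [inr_mem_toList_disjSum])]
    exact X_mul_X_mem_map_specialize hA hB hi' hj'
  have hone : ∀ k ∈ (A.disjSum B).toList, (X k - 1 : MvPolynomial (Fin n ⊕ Fin m) K) ∈ a :=
    fun k hk => hle (Ideal.mem_sup_right (Ideal.subset_span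
      (List.mem_map_of_mem (f := fun k => (X k - 1 : MvPolynomial (Fin n ⊕ Fin m) K)) hk)))
  -- Modulo the colon ideal of `x_i` every variable equals its coordinate at the point, so `f` is
  -- congruent to its value there.
  have key := sub_aeval_mem (J := a.colon {X (Sum.inl i)})
    (g := fun k => C (indicatorPoint K A B k)) (fun k => ?_) f
  · have : aeval (fun k => C (indicatorPoint K A B k)) f =
        (C (eval (indicatorPoint K A B) f) : MvPolynomial (Fin n ⊕ Fin m) K) := by
      have : (aeval (fun k => C (indicatorPoint K A B k)) :
          MvPolynomial (Fin n ⊕ Fin m) K →ₐ[K] MvPolynomial (Fin n ⊕ Fin m) K) =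
          (Algebra.ofId K _).comp (aeval (indicatorPoint K A B)) := by
        ext1 k
        simp [Algebra.ofId_apply, algebraMap_eq]
      rw [this]
      simp [Algebra.ofId_apply, algebraMap_eq, aeval_eq_eval]
    rwa [this, hf, map_zero, sub_zero, Submodule.mem_colon_singleton] at key
  · rw [Submodule.mem_colon_singleton, smul_eq_mul]
    rcases k with k | k
    · by_cases hk : k ∈ A
      · have := hone (Sum.inl k) (by rwa [inl_mem_toList_disjSum])
        simpa [indicatorPoint, hk] using Ideal.mul_mem_right (X (Sum.inl i)) _ this
      -- Here `x_k * x_i = x_k * (x_i + y_j) - x_k * y_j`, and both terms lie in `a`.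
      · have := sub_mem (Ideal.mul_mem_left _ (X (Sum.inl k)) hw) (hxy k hk j hj)
        simpa [indicatorPoint, hk, mul_add] using this
    · by_cases hk : k ∈ B
      · have := hone (Sum.inr k) (by rwa [inr_mem_toList_disjSum])
        simpa [indicatorPoint, hk] using Ideal.mul_mem_right (X (Sum.inl i)) _ this
      · simpa [indicatorPoint, hk, mul_comm] using hxy i hi k hk

lemma idealDepth_ker_lift_eval (hA : A.card + 1 = q) (hB : B.card + 1 = r) (hqn : q ≤ n)
    (hrm : r ≤ m) :
    idealDepth (RingHom.ker (Ideal.Quotient.lift (idealX K n m q * idealY K n m r)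
      (eval (indicatorPoint K A B)) fun _ => eval_indicatorPoint_eq_zero (by omega))) =
      (A.card + B.card + 1 : ℕ) := by
  obtain ⟨i, -, hi⟩ := Finset.exists_mem_notMem_of_card_lt_card (s := A) (t := Finset.univ)
    (by rw [Finset.card_univ, Fintype.card_fin]; omega)
  obtain ⟨j, -, hj⟩ := Finset.exists_mem_notMem_of_card_lt_card (s := B) (t := Finset.univ)
    (by rw [Finset.card_univ, Fintype.card_fin]; omega)
  rw [idealDepth_eq_length ?_ (isWeaklyRegular_idealX_mul_idealY hA hB hi hj)
    (s := Ideal.Quotient.mk _ (X (Sum.inl i)))]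
  · simp
  · rw [← Ideal.map_ofList, mk_mem_map_mk_iff]
    exact X_notMem_sup hA hB hi hj
  · intro x hx
    obtain ⟨f, rfl⟩ := Ideal.Quotient.mk_surjective x
    rw [← map_mul, ← Ideal.map_ofList, mk_mem_map_mk_iff]
    exact mul_X_mem_sup hA hB hi hj hx
  · intro x hx
    obtain ⟨f, hf, rfl⟩ := List.mem_map.mp hx
    rw [RingHom.mem_ker, Ideal.Quotient.lift_mk]
    rw [List.mem_append, List.mem_map, List.mem_singleton] at hf
    rcases hf with ⟨k, hk, rfl⟩ | rfl
    · rcases k with k | k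
      · rw [inl_mem_toList_disjSum] at hk
        simp [indicatorPoint, hk]
      · rw [inr_mem_toList_disjSum] at hk
        simp [indicatorPoint, hk]
    · simp [indicatorPoint, hi, hj]

lemma eq_and_eq_of_isCohenMacaulay (hq : 1 ≤ q) (hqn : q ≤ n) (hr : 1 ≤ r) (hrm : r ≤ m)
    (hCM : IsCohenMacaulay
      (MvPolynomial (Fin n ⊕ Fin m) K ⧸ idealX K n m q * idealY K n m r)) :
    q = n ∧ r = m := by
  obtain ⟨A, -, hA⟩ := Finset.exists_subset_card_eq (s := (Finset.univ : Finset (Fin n)))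
    (n := q - 1) (by rw [Finset.card_univ, Fintype.card_fin]; omega)
  obtain ⟨B, -, hB⟩ := Finset.exists_subset_card_eq (s := (Finset.univ : Finset (Fin m)))
    (n := r - 1) (by rw [Finset.card_univ, Fintype.card_fin]; omega)
  have hA' : A.card + 1 = q := by omega
  have hB' : B.card + 1 = r := by omega
  have hmax := RingHom.ker_isMaximal_of_surjective
    (Ideal.Quotient.lift (idealX K n m q * idealY K n m r) (eval (indicatorPoint K A B))
      fun _ => eval_indicatorPoint_eq_zero (by omega))
    (fun c => ⟨Ideal.Quotient.mk _ (C c), by simp⟩)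
  have hdepth := hCM.2 _ hmax
  rw [idealDepth_ker_lift_eval hA' hB' hqn hrm] at hdepth
  -- The component where the `x_i` with `i ∉ A` vanish has dimension `m + q - 1`; the depth `q + r -
  -- 1` can reach this only if `m ≤ r`. The other component gives `n ≤ q` in the same way.
  have hx := card_sub_le_height (F := Aᶜ.map Function.Embedding.inl)
    (I := idealX K n m q * idealY K n m r) (a := indicatorPoint K A B)
    (Ideal.mul_le_left.trans (idealX_le_of_forall_notMem (A := A) (by omega) fun i hi => by
      rw [RingHom.mem_ker, partialEval_X_of_mem _ (by simpa using hi)]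
      simp [indicatorPoint, hi])) fun _ => eval_indicatorPoint_eq_zero (by omega)
  have hy := card_sub_le_height (F := Bᶜ.map Function.Embedding.inr)
    (I := idealX K n m q * idealY K n m r) (a := indicatorPoint K A B)
    (Ideal.mul_le_right.trans (idealY_le_of_forall_notMem (B := B) (by omega) fun j hj => by
      rw [RingHom.mem_ker, partialEval_X_of_mem _ (by simpa using hj)]
      simp [indicatorPoint, hj])) fun _ => eval_indicatorPoint_eq_zero (by omega)
  rw [← hdepth, Nat.cast_le, Finset.card_map, Finset.card_compl, Fintype.card_sum,
    Fintype.card_fin, Fintype.card_fin] at hx hy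
  omega

/-! ### The principal case `q = n`, `r = m` -/

lemma idealX_self : idealX K n m n = Ideal.span {∏ i, X (Sum.inl i)} := by
  rw [idealX]
  congr 1
  ext f
  constructor
  · rintro ⟨A, hA, rfl⟩
    rw [(Finset.card_eq_iff_eq_univ A).mp (by simpa using hA)]
    rfl
  · rintro rfl
    exact ⟨Finset.univ, by simp, rfl⟩

lemma idealY_self : idealY K n m m = Ideal.span {∏ j, X (Sum.inr j)} := by
  rw [idealY]
  congr 1
  ext f
  constructor
  · rintro ⟨B, hB, rfl⟩
    rw [(Finset.card_eq_iff_eq_univ B).mp (by simpa using hB)]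
    rfl
  · rintro rfl
    exact ⟨Finset.univ, by simp, rfl⟩

lemma idealX_mul_idealY_self : idealX K n m n * idealY K n m m =
    Ideal.span {(∏ i, X (Sum.inl i)) * ∏ j, X (Sum.inr j)} := by
  rw [idealX_self, idealY_self, Ideal.span_singleton_mul_span_singleton]

lemma typeAt_quotient_idealX_mul_idealY_self
    (P : Ideal (MvPolynomial (Fin n ⊕ Fin m) K ⧸ idealX K n m n * idealY K n m m))
    [hP : P.IsMaximal] : typeAt P = 1 := by
  have hmax := Ideal.comap_isMaximal_of_surjective
    (Ideal.Quotient.mk (idealX K n m n * idealY K n m m)) Ideal.Quotient.mk_surjective (K := P)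
  obtain ⟨gs, hgs, hgsP⟩ := MaximalIdealsRegular.mvPolynomial K (Fin n ⊕ Fin m) _ hmax
  refine typeAt_eq_one (S := MvPolynomial (Fin n ⊕ Fin m) K)
    (f := (∏ i, X (Sum.inl i)) * ∏ j, X (Sum.inr j)) Ideal.Quotient.mk_surjective ?_ ?_ P hgs
    hgsP.symm
  · refine IsSMulRegular.of_ne_zero (mul_ne_zero ?_ ?_)
    · exact Finset.prod_ne_zero_iff.mpr fun i _ => X_ne_zero _
    · exact Finset.prod_ne_zero_iff.mpr fun j _ => X_ne_zero _
  · rw [Ideal.Quotient.algebraMap_eq, Ideal.mk_ker, idealX_mul_idealY_self]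

lemma isMaximal_span_range_X {σ : Type*} :
    (Ideal.span (Set.range (X : σ → MvPolynomial σ K))).IsMaximal := by
  have : Ideal.span (Set.range (X : σ → MvPolynomial σ K)) =
      RingHom.ker (constantCoeff : MvPolynomial σ K →+* K) := by
    apply le_antisymm
    · refine Ideal.span_le.mpr ?_
      rintro _ ⟨i, rfl⟩
      simp [RingHom.mem_ker]
    · intro f hf
      have := sub_aeval_mem (J := Ideal.span (Set.range (X : σ → MvPolynomial σ K)))
        (g := fun _ => 0) (fun i => by
          rw [sub_zero]
          exact Ideal.subset_span ⟨i, rfl⟩) f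
      rwa [aeval_zero', RingHom.mem_ker.mp hf, map_zero, sub_zero] at this
  rw [this]
  exact RingHom.ker_isMaximal_of_surjective _ fun c => ⟨C c, by simp⟩

lemma isMaximal_map_mk_span_range_X (hq : 1 ≤ q) :
    ((Ideal.span (Set.range (X : _ → MvPolynomial (Fin n ⊕ Fin m) K))).map
      (Ideal.Quotient.mk (idealX K n m q * idealY K n m r))).IsMaximal := by
  have hmax := isMaximal_span_range_X (K := K) (σ := Fin n ⊕ Fin m)
  refine (Ideal.map_eq_top_or_isMaximal_of_surjective _ Ideal.Quotient.mk_surjective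
    hmax).resolve_left fun h => hmax.ne_top ?_
  rw [Ideal.eq_top_iff_one, ← map_one (Ideal.Quotient.mk _), mk_mem_map_mk_iff, sup_eq_right.mpr,
    ← Ideal.eq_top_iff_one] at h
  · exact h
  -- With `A = ∅`, the bound `1 ≤ q` says that each generator of `I_q` involves a variable, so the
  -- ideal lies in the one generated by the variables.
  · exact Ideal.mul_le_left.trans (idealX_le_of_forall_notMem (A := ∅)
      (by rw [Finset.card_empty]; omega)
      fun i _ => Ideal.subset_span ⟨_, rfl⟩)

end MixedProductIdeal

end MixedProduct

theorem mainTheorem7 {K : Type*} [Field K] (n m q r : ℕ)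
    (hq : 1 ≤ q) (hqn : q ≤ n) (hr : 1 ≤ r) (hrm : r ≤ m)
    (hCM : MixedProduct.IsCohenMacaulay
      (MvPolynomial (Fin n ⊕ Fin m) K ⧸
        MixedProduct.idealX K n m q * MixedProduct.idealY K n m r)) :
    q = n ∧ r = m ∧
      (MixedProduct.idealX K n m q * MixedProduct.idealY K n m r).IsPrincipal ∧
      MixedProduct.gradedType
        (MixedProduct.idealX K n m q * MixedProduct.idealY K n m r) = 1 ∧
      MixedProduct.IsGorenstein
        (MvPolynomial (Fin n ⊕ Fin m) K ⧸
          MixedProduct.idealX K n m q * MixedProduct.idealY K n m r) := by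
  obtain ⟨rfl, rfl⟩ := MixedProduct.eq_and_eq_of_isCohenMacaulay hq hqn hr hrm hCM
  have := MixedProduct.isMaximal_map_mk_span_range_X (K := K) (n := q) (m := r) (r := r) hq
  exact ⟨rfl, rfl, ⟨_, MixedProduct.idealX_mul_idealY_self⟩,
    MixedProduct.typeAt_quotient_idealX_mul_idealY_self _, hCM,
    fun P _ => MixedProduct.typeAt_quotient_idealX_mul_idealY_self P⟩
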